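/- Let $n \ge 1$. A proper cone in a finite-dimensional real space $V$ is a closed convex cone $K$ with $K \cap (-K) = \{0\}$ and nonempty interior. A linear operator $T$ on $V$ is $K$-primitive if $TK \subseteq K$ and the only nonempty subset $S$ of the boundary $\partial K$ with $TS \subseteq S$ is $\{0\}$. A linear operator $A : \mathbb{R}^n \to \mathbb{R}^n$ is generalized even oscillatory if for every even $j$ with $1 \le j \le n$ its exterior power $\wedge^j A$, acting on $\wedge^j \mathbb{R}^n = \mathbb{R}^{\binom{n}{j}}$, is $K_j$-primitive for some proper cone $K_j \subset \mathbb{R}^{\binom{n}{j}}$. Theorem. Let $A : \mathbb{R}^n \to \mathbb{R}^n$ be generalized even oscillatory. Then every complex eigenvalue of $A$ has algebraic multiplicity at most $2$. Moreover, let $\lambda_1, \dots, \lambda_n$ be the complex eigenvalues of $A$, repeated according to algebraic multiplicity and enumerated in any way such that $|\lambda_1| \ge |\lambda_2| \ge \dots \ge |\lambda_n|$, and let $\rho(A)$ be the spectral radius of $A$. Then $$\rho(A) = |\lambda_1| \ge |\lambda_2| > |\lambda_3| \ge |\lambda_4| > \cdots,$$ that is, $|\lambda_i| > |\lambda_{i+1}|$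 for every even $i$ with $2 \le i < n$. For every odd $i$ with $1 \le i < n$ and $\lambda_{i+1} \ne 0$ one has $\arg \lambda_{i+1} = -\arg \lambda_i$ modulo $2\pi$. If $n$ is odd, then $\lambda_n$ is real. -/

import Mathlib

/-- A proper cone: a convex cone (closed under addition and under multiplication by nonnegative
reals) that is topologically closed, pointed (`K ∩ (-K) = {0}`) and solid. -/
structure IsProperCone {V : Type*} [AddCommGroup V] [Module ℝ V] [TopologicalSpace V]
    (K : PointedCone ℝ V) : Prop where
  isClosed : IsClosed (K : Set V)
  pointed : ∀ x ∈ K, -x ∈ K → x = 0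
  solid : (interior (K : Set V)).Nonempty

/-- `T` is primitive with respect to `K`: `T K ⊆ K`, and the only nonempty subset of the boundary
of `K` that is left invariant by `T` is `{0}`. -/
def IsConePrimitive {V : Type*} [AddCommGroup V] [Module ℝ V] [TopologicalSpace V]
    (K : PointedCone ℝ V) (T : V →ₗ[ℝ] V) : Prop :=
  Set.MapsTo T (K : Set V) (K : Set V) ∧
    ∀ S : Set V, S.Nonempty → S ⊆ frontier (K : Set V) → Set.MapsTo T S S → S = {0}

/-- The `j`-th exterior power of an operator `A` on `ℝⁿ`, read as an operator on the coordinate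
space `ℝ^(n choose j)` through the canonical basis `e_{i₁} ∧ ⋯ ∧ e_{iⱼ}`, `i₁ < ⋯ < iⱼ`. -/
noncomputable def exteriorPowerOperator {n : ℕ} (j : ℕ) (A : (Fin n → ℝ) →ₗ[ℝ] (Fin n → ℝ)) :
    (Set.powersetCard (Fin n) j → ℝ) →ₗ[ℝ] (Set.powersetCard (Fin n) j → ℝ) :=
  ((Pi.basisFun ℝ (Fin n)).exteriorPower j).equivFun.conj (exteriorPower.map j A)

/-- Generalized even oscillatory operators: for every even `j` with `1 ≤ j ≤ n`, the `j`-th exterior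
power is primitive with respect to some proper cone. -/
def IsGeneralizedEvenOscillatory {n : ℕ} (A : (Fin n → ℝ) →ₗ[ℝ] (Fin n → ℝ)) : Prop :=
  ∀ j : ℕ, 1 ≤ j → j ≤ n → Even j →
    ∃ K : PointedCone ℝ (Set.powersetCard (Fin n) j → ℝ),
      IsProperCone K ∧ IsConePrimitive K (exteriorPowerOperator j A)

/-- `ev 1, …, ev n` are the complex eigenvalues of `A`, repeated according to algebraic
multiplicity and enumerated by nonincreasing modulus (other values of `ev` are irrelevant). -/
structure IsEigenvalueEnumeration {n : ℕ} (A : (Fin n → ℝ) →ₗ[ℝ] (Fin n → ℝ))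
    (ev : ℕ → ℂ) : Prop where
  eigenvalues : (Finset.Icc 1 n).val.map ev = A.charpoly.aroots ℂ
  antitone : ∀ i k : ℕ, 1 ≤ i → i ≤ k → k ≤ n → ‖ev k‖ ≤ ‖ev i‖

/-! The eigenvalues of the `j`-th exterior power are the products of `j` eigenvalues of `A`. By
Perron–Frobenius for cones (`exists_dominant_eigenvalue`), in dimension at least two a primitive
operator has a simple positive eigenvalue strictly larger in modulus than all the others. For even
`j < n` this eigenvalue must be the product of the `j` leading eigenvalues. Exchanging factor `j`
for factor `j + 1` gives another eigenvalue of the exterior power, hence a strictly smaller modulus,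
so there is a gap after each even position.

The gaps confine equal eigenvalues to one pair, and for odd `n` they isolate the last eigenvalue,
which must then equal its conjugate. Quotients of successive even leading products are positive when
the pair is nonzero, so the arguments in that pair cancel.

The Perron vector is found by minimizing `r` subject to `r • x - T x ∈ K`. Dominance comes from
fitting a rotating ellipse into the cone around the Perron vector: the smallest multiple of that
vector that suffices could still be lowered. -/

/-! ### Eigenvalues of exterior powers. -/

open Polynomial in
theorem Matrix.BlockTriangular.charpoly_of_injective {m α R : Type*} [Fintype m] [DecidableEq m]
    [LinearOrder α] [CommRing R] {M : Matrix m m R} {b : m → α} (h : M.BlockTriangular b)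
    (hb : Function.Injective b) : M.charpoly = ∏ i, (X - C (M i i)) := by
  let _ : LinearOrder m := LinearOrder.lift' b hb
  have h' : M.IsUpperTriangular := fun i j hij => h hij
  convert Matrix.charpoly_of_isUpperTriangular M h'

open Module in
/-- Every endomorphism over an algebraically closed field is triangular in some basis. -/
theorem Module.End.exists_basis_isUpperTriangular {K : Type*} [Field K] [IsAlgClosed K] (n : ℕ) :
    ∀ (V : Type _) [AddCommGroup V] [Module K V] [FiniteDimensional K V] (f : End K V),
      finrank K V = n → ∃ b : Basis (Fin n) K V, (LinearMap.toMatrix b b f).IsUpperTriangular := by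
  induction n with
  | zero =>
    intro V _ _ _ f hV
    exact ⟨finBasisOfFinrankEq K V hV, fun i => i.elim0⟩
  | succ n ih =>
    intro V _ _ _ f hV
    have : Nontrivial V := nontrivial_of_finrank_pos (R := K) (by omega)
    obtain ⟨μ, hμ⟩ := End.exists_eigenvalue f
    set g : End K V := f - algebraMap K (End K V) μ with hg
    have hrange : LinearMap.range g ≠ ⊤ := by
      intro htop
      have hinj : Function.Injective g :=
        LinearMap.injective_iff_surjective.2 (LinearMap.range_eq_top.1 htop)
      obtain ⟨x, hx⟩ := hμ.exists_hasEigenvector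
      refine hx.2 (hinj ?_)
      simp [hg, hx.apply_eq_smul]
    -- A hyperplane containing the range of `f - μ` is `f`-invariant. Induction triangularizes `f`
    -- there, and any vector outside it can be appended as the last basis vector.
    obtain ⟨φ, hφ, hle⟩ := Submodule.exists_le_ker_of_lt_top _ (lt_top_iff_ne_top.2 hrange)
    obtain ⟨y, hy⟩ : ∃ y, φ y ≠ 0 := by
      by_contra! h
      exact hφ (LinearMap.ext h)
    set W := LinearMap.ker φ
    have hfg : ∀ x, f x = g x + μ • x := by intro x; simp [hg]
    have hW : ∀ x ∈ W, f x ∈ W := by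
      intro x hx
      rw [hfg]
      exact W.add_mem (hle ⟨x, rfl⟩) (W.smul_mem _ hx)
    have hWrank : finrank K W = n := by
      have h1 := LinearMap.finrank_range_add_finrank_ker φ
      have h2 : LinearMap.range φ = ⊤ := LinearMap.range_eq_top.2 (LinearMap.surjective hφ)
      rw [h2, finrank_top, finrank_self] at h1
      change finrank K (LinearMap.ker φ) = n
      omega
    obtain ⟨b, hb⟩ := ih W (f.restrict hW) hWrank
    have hli : ∀ (c : K), ∀ x ∈ W, c • y + x = 0 → c = 0 := by
      intro c x hx h
      have := congrArg φ h
      rw [map_add, map_smul, LinearMap.mem_ker.1 hx] at this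
      simpa [hy] using this
    have hsp : ∀ z : V, ∃ c : K, z + c • y ∈ W := by
      intro z
      refine ⟨-(φ z / φ y), ?_⟩
      rw [LinearMap.mem_ker, map_add, map_smul]
      simp [hy]
    set B := Basis.mkFinSnoc b y hli hsp
    have hBc : ∀ i : Fin n, B i.castSucc = b i := by
      intro i; simp [B]
    have hBl : B (Fin.last n) = y := by simp [B]
    have hrepr : ∀ (w : W) (i : Fin (n + 1)),
        B.repr w i = Fin.snoc (α := fun _ => K) (fun k => b.repr w k) 0 i := by
      intro w i
      have hw : (w : V) = ∑ k, b.repr w k • B k.castSucc := by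
        have h := congrArg W.subtype (b.sum_repr w).symm
        rw [map_sum] at h
        simpa only [hBc, map_smul, Submodule.subtype_apply] using h
      rw [hw]
      simp only [map_sum, map_smul, Basis.repr_self, Finsupp.coe_finsetSum, Finset.sum_apply,
        Finsupp.smul_apply, smul_eq_mul]
      refine Fin.lastCases ?_ (fun k => ?_) i
      · simp [(Fin.castSucc_lt_last _).ne]
      · simp [Finsupp.single_apply]
    refine ⟨B, fun i k hik => ?_⟩
    rw [LinearMap.toMatrix_apply]
    simp only [id] at hik
    induction k using Fin.lastCases with
    | last => exact absurd hik (Fin.le_last i).not_gt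
    | cast k =>
      have := hrepr (f.restrict hW (b k)) i
      rw [hBc]
      rw [LinearMap.coe_restrict_apply] at this
      rw [this]
      induction i using Fin.lastCases with
      | last => simp
      | cast i =>
        have h := hb (i := i) (j := k) (by simpa using hik)
        rw [LinearMap.toMatrix_apply] at h
        simpa using h

theorem exteriorPower.toMatrix_map {R M : Type*} [CommRing R] [AddCommGroup M] [Module R M] {n : ℕ}
    (b : Module.Basis (Fin n) R M) (j : ℕ) (f : M →ₗ[R] M) (s t : Set.powersetCard (Fin n) j) :
    LinearMap.toMatrix (b.exteriorPower j) (b.exteriorPower j) (exteriorPower.map j f) s t =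
      (Matrix.of fun i k => LinearMap.toMatrix b b f (Set.powersetCard.ofFinEmbEquiv.symm s k)
        (Set.powersetCard.ofFinEmbEquiv.symm t i)).det := by
  rw [LinearMap.toMatrix_apply, exteriorPower.basis_repr_apply, exteriorPower.basis_apply,
    exteriorPower.map_apply_ιMulti_family, exteriorPower.ιMulti_family,
    exteriorPower.ιMultiDual_apply_ιMulti]
  simp only [LinearMap.toMatrix_apply, Module.Basis.coord_apply, Function.comp_apply]

theorem Set.powersetCard.prod_ofFinEmbEquiv_symm {I M : Type*} [LinearOrder I] [CommMonoid M]
    {j : ℕ} (s : Set.powersetCard I j) (g : I → M) :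
    ∏ i, g (Set.powersetCard.ofFinEmbEquiv.symm s i) = ∏ i ∈ s.val, g i := by
  have h : s.val = Finset.univ.map (Set.powersetCard.ofFinEmbEquiv.symm s).toEmbedding := by
    ext i
    rw [Set.powersetCard.mem_coe_iff, ← Set.powersetCard.mem_range_ofFinEmbEquiv_symm_iff_mem]
    simp
  rw [h, Finset.prod_map]
  rfl

theorem Set.powersetCard.map_univ_val (I : Type*) [Fintype I] (j : ℕ) {β : Type*}
    (g : Finset I → β) :
    (Finset.univ : Finset (Set.powersetCard I j)).val.map (fun s => g s.val) =
      (Finset.powersetCard j (Finset.univ : Finset I)).val.map g := by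
  have h : (Finset.univ : Finset (Set.powersetCard I j)).map (Function.Embedding.subtype _) =
      Finset.powersetCard j (Finset.univ : Finset I) := by
    ext s
    simp [Set.powersetCard.mem_iff]
  rw [← h, Finset.map_val, Multiset.map_map]
  rfl

-- A nonzero term of the minor with rows `s` and columns `t` matches each element of `s` with one of
-- `t` at least as large, so the weight `∑ 2 ^ i` of `s` is at most that of `t`. Binary expansions
-- make this weight injective, so it triangularizes the compound matrix, whose diagonal consists of
-- triangular principal minors.
open Polynomial in
theorem exteriorPower.charpoly_toMatrix_map_of_isUpperTriangular {R M : Type*} [CommRing R]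
    [AddCommGroup M] [Module R M] {n : ℕ}
    (b : Module.Basis (Fin n) R M) (j : ℕ) (f : M →ₗ[R] M)
    (h : (LinearMap.toMatrix b b f).IsUpperTriangular) :
    (LinearMap.toMatrix (b.exteriorPower j) (b.exteriorPower j) (exteriorPower.map j f)).charpoly =
      ∏ s : Set.powersetCard (Fin n) j, (X - C (∏ i ∈ s.val, LinearMap.toMatrix b b f i i)) := by
  set T := LinearMap.toMatrix b b f
  let w : Set.powersetCard (Fin n) j → ℕ := fun s => ∑ i ∈ s.val, 2 ^ (i : ℕ)
  have hw : Function.Injective w := by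
    intro s t hst
    have hmap : ∀ s : Set.powersetCard (Fin n) j,
        ∑ i ∈ s.val.map Fin.valEmbedding, 2 ^ i = w s := by
      intro s; simp [w]
    have := Finset.equivBitIndices.symm.injective ((hmap s).trans (hst.trans (hmap t).symm))
    exact Subtype.ext (Finset.map_injective _ this)
  have hw' : ∀ s, w s = ∑ i, 2 ^ (Set.powersetCard.ofFinEmbEquiv.symm s i : ℕ) := by
    intro s
    exact (Set.powersetCard.prod_ofFinEmbEquiv_symm (M := Multiplicative ℕ) s
      (fun i => Multiplicative.ofAdd (2 ^ (i : ℕ)))).symm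
  have htri : (LinearMap.toMatrix (b.exteriorPower j) (b.exteriorPower j)
      (exteriorPower.map j f)).BlockTriangular w := by
    intro s t hst
    rw [exteriorPower.toMatrix_map, Matrix.det_apply]
    refine Finset.sum_eq_zero fun σ _ => ?_
    suffices ∃ i, T (Set.powersetCard.ofFinEmbEquiv.symm s i)
        (Set.powersetCard.ofFinEmbEquiv.symm t (σ i)) = 0 by
      obtain ⟨i, hi⟩ := this
      rw [Finset.prod_eq_zero (Finset.mem_univ i) (by simpa using hi), smul_zero]
    by_contra! hne
    have hle : ∀ i, Set.powersetCard.ofFinEmbEquiv.symm s i ≤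
        Set.powersetCard.ofFinEmbEquiv.symm t (σ i) := fun i =>
      not_lt.1 fun hlt => hne i (h hlt)
    refine hst.not_ge ?_
    rw [hw', hw', ← Equiv.sum_comp σ fun i => 2 ^ (Set.powersetCard.ofFinEmbEquiv.symm t i : ℕ)]
    exact Finset.sum_le_sum fun i _ => Nat.pow_le_pow_right two_pos (hle i)
  rw [htri.charpoly_of_injective hw]
  refine Finset.prod_congr rfl fun s _ => ?_
  rw [exteriorPower.toMatrix_map, ← Matrix.det_transpose, Matrix.det_of_isUpperTriangular]
  · simp only [Matrix.transpose_apply, Matrix.of_apply]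
    rw [Set.powersetCard.prod_ofFinEmbEquiv_symm s (fun i => T i i)]
  · intro i k hik
    exact h ((Set.powersetCard.ofFinEmbEquiv.symm s).strictMono hik)

-- The matrix of `A` becomes triangular over `ℂ` in a suitable basis. Minors commute with the
-- extension of scalars and characteristic polynomials ignore the basis, so the triangular case
-- suffices.
open Polynomial in
theorem charpoly_aroots_exteriorPowerOperator {n : ℕ} (j : ℕ)
    (A : (Fin n → ℝ) →ₗ[ℝ] (Fin n → ℝ)) :
    (exteriorPowerOperator j A).charpoly.aroots ℂ =
      (Multiset.powersetCard j (A.charpoly.aroots ℂ)).map Multiset.prod := by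
  set e := Pi.basisFun ℝ (Fin n)
  set e' := Pi.basisFun ℂ (Fin n)
  set f : Module.End ℂ (Fin n → ℂ) :=
    Matrix.toLin' ((LinearMap.toMatrix e e A).map (algebraMap ℝ ℂ)) with hf
  have hfM : LinearMap.toMatrix e' e' f = (LinearMap.toMatrix e e A).map (algebraMap ℝ ℂ) := by
    rw [hf, ← Matrix.toLin_eq_toLin']
    exact LinearMap.toMatrix_toLin _ _ _
  obtain ⟨b, hb⟩ := Module.End.exists_basis_isUpperTriangular n (Fin n → ℂ) f (by simp)
  have hA : A.charpoly.map (algebraMap ℝ ℂ) =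
      ∏ i, (X - C (LinearMap.toMatrix b b f i i)) := by
    rw [← Matrix.charpoly_of_isUpperTriangular _ hb, LinearMap.charpoly_toMatrix,
      ← LinearMap.charpoly_toMatrix f e', hfM, ← LinearMap.charpoly_toMatrix A e,
      Matrix.charpoly_map]
  have hE : (exteriorPowerOperator j A).charpoly.map (algebraMap ℝ ℂ) =
      ∏ s : Set.powersetCard (Fin n) j,
        (X - C (∏ i ∈ s.val, LinearMap.toMatrix b b f i i)) := by
    rw [← exteriorPower.charpoly_toMatrix_map_of_isUpperTriangular b j f hb,
      LinearMap.charpoly_toMatrix, ← LinearMap.charpoly_toMatrix _ (e'.exteriorPower j),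
      exteriorPowerOperator, LinearEquiv.charpoly_conj,
      ← LinearMap.charpoly_toMatrix _ (e.exteriorPower j), ← Matrix.charpoly_map]
    congr 1
    ext s t
    rw [Matrix.map_apply, exteriorPower.toMatrix_map, exteriorPower.toMatrix_map, RingHom.map_det,
      hfM]
    rfl
  have hroots : ∀ {ι : Type} [Fintype ι] (g : ι → ℂ),
      (∏ i, (X - C (g i))).roots = Finset.univ.val.map g := by
    intro ι _ g
    rw [← roots_multiset_prod_X_sub_C (Finset.univ.val.map g), Multiset.map_map]
    rfl
  rw [aroots_def, aroots_def, hA, hE, hroots, hroots, Multiset.powersetCard_map, Multiset.map_map,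
    ← Finset.map_val_val_powersetCard, Multiset.map_map]
  exact (Set.powersetCard.map_univ_val (Fin n) j
    fun s => ∏ i ∈ s, LinearMap.toMatrix b b f i i).symm ▸ rfl

/-! ### Proper cones and Perron–Frobenius theory. -/

section ProperCone

variable {V : Type*} [NormedAddCommGroup V] [NormedSpace ℝ V] {K : PointedCone ℝ V}

namespace PointedCone

theorem smul_mem_of_nonneg {c : ℝ} (hc : 0 ≤ c) {x : V} (hx : x ∈ K) : c • x ∈ K :=
  K.smul_mem hc hx

theorem add_mem_interior {x y : V} (hx : x ∈ interior (K : Set V)) (hy : y ∈ K) :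
    x + y ∈ interior (K : Set V) := by
  have h : (fun z => z + y) '' interior (K : Set V) ⊆ interior (K : Set V) := by
    refine interior_maximal ?_ ((Homeomorph.addRight y).isOpenMap _ isOpen_interior)
    rintro _ ⟨z, hz, rfl⟩
    exact K.add_mem (interior_subset hz) hy
  exact h ⟨x, hx, rfl⟩

theorem smul_mem_interior {c : ℝ} (hc : 0 < c) {x : V} (hx : x ∈ interior (K : Set V)) :
    c • x ∈ interior (K : Set V) := by
  have h : (fun z => c • z) '' interior (K : Set V) ⊆ interior (K : Set V) := by
    refine interior_maximal ?_ ((Homeomorph.smulOfNeZero c hc.ne').isOpenMap _ isOpen_interior)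
    rintro _ ⟨z, hz, rfl⟩
    exact smul_mem_of_nonneg hc.le (interior_subset hz)
  exact h ⟨x, hx, rfl⟩

/-- Interior points absorb every vector, after scaling down. -/
theorem exists_pos_add_smul_mem_interior {x : V} (hx : x ∈ interior (K : Set V)) (y : V) :
    ∃ ε : ℝ, 0 < ε ∧ x + ε • y ∈ interior (K : Set V) := by
  have hcont : Continuous fun ε : ℝ => x + ε • y := by fun_prop
  have h : ∀ᶠ ε : ℝ in nhds 0, x + ε • y ∈ interior (K : Set V) :=
    hcont.continuousAt.eventually_mem (isOpen_interior.mem_nhds (by simpa using hx))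
  obtain ⟨ε, hε, hpos⟩ := ((h.filter_mono nhdsWithin_le_nhds).and
    (self_mem_nhdsWithin (s := Set.Ioi (0 : ℝ)))).exists
  exact ⟨ε, hpos, hε⟩

end PointedCone

open PointedCone

namespace IsProperCone

variable (hK : IsProperCone K)
include hK

theorem zero_notMem_interior [Nontrivial V] : (0 : V) ∉ interior (K : Set V) := by
  intro h
  obtain ⟨x, hx⟩ := exists_ne (0 : V)
  obtain ⟨a, ha, h1⟩ := exists_pos_add_smul_mem_interior h x
  obtain ⟨b, hb, h2⟩ := exists_pos_add_smul_mem_interior h (-x)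
  rw [zero_add] at h1 h2
  have h1' := smul_mem_of_nonneg (inv_nonneg.2 ha.le) (interior_subset h1)
  have h2' := smul_mem_of_nonneg (inv_nonneg.2 hb.le) (interior_subset h2)
  rw [inv_smul_smul₀ ha.ne'] at h1'
  rw [inv_smul_smul₀ hb.ne'] at h2'
  exact hx (hK.pointed x h1' h2')

theorem nonneg_of_smul_mem {x : V} (hx : x ∈ K) (hx0 : x ≠ 0) {c : ℝ} (h : c • x ∈ K) : 0 ≤ c := by
  by_contra! hc
  have := smul_mem_of_nonneg (inv_nonneg.2 (neg_nonneg.2 hc.le)) h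
  rw [smul_smul, inv_neg, neg_mul, inv_mul_cancel₀ hc.ne, neg_one_smul] at this
  exact hx0 (hK.pointed x hx this)

/-- A segment from an interior point `e` to a point outside `K` and off the line of `e` crosses the
boundary by connectedness, and it misses the origin. -/
theorem exists_mem_frontier_ne_zero [FiniteDimensional ℝ V] (hV : 1 < Module.finrank ℝ V) :
    ∃ x ∈ frontier (K : Set V), x ≠ 0 := by
  have : Nontrivial V := Module.nontrivial_of_finrank_pos (R := ℝ) (by omega)
  obtain ⟨e, he⟩ := hK.solid
  have hspan : Submodule.span ℝ {e} ≠ ⊤ := by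
    intro h
    have := finrank_span_le_card (R := ℝ) ({e} : Set V)
    rw [h, finrank_top] at this
    simp at this
    omega
  obtain ⟨w, hw, hwK⟩ : ∃ w, w ∉ Submodule.span ℝ {e} ∧ w ∉ K := by
    obtain ⟨w, -, hw⟩ := SetLike.exists_of_lt (lt_top_iff_ne_top.2 hspan)
    by_cases h : w ∈ K
    · refine ⟨-w, by simpa using hw, fun h' => hw ?_⟩
      rw [hK.pointed w h h']
      exact Submodule.zero_mem _
    · exact ⟨w, hw, h⟩
  have hseg := (convex_segment e w).isPreconnected
  obtain ⟨x, hx, hxK⟩ : ∃ x ∈ segment ℝ e w, x ∈ frontier (K : Set V) := by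
    by_contra! h
    obtain ⟨x, -, hxi, hxc⟩ := hseg (interior (K : Set V)) (K : Set V)ᶜ isOpen_interior
      hK.isClosed.isOpen_compl
      (fun x hx => by
        by_contra hx'
        rw [Set.mem_union, not_or, Set.notMem_compl_iff] at hx'
        exact h x hx (hK.isClosed.frontier_eq ▸ ⟨hx'.2, hx'.1⟩))
      ⟨e, left_mem_segment ℝ e w, he⟩ ⟨w, right_mem_segment ℝ e w, hwK⟩
    exact hxc (interior_subset hxi)
  refine ⟨x, hxK, ?_⟩
  rintro rfl
  obtain ⟨a, b, ha, hb, hab, h⟩ := hx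
  rcases eq_or_ne b 0 with rfl | hb0
  · simp only [add_zero] at hab
    subst hab
    simp only [one_smul, zero_smul, add_zero] at h
    exact hK.zero_notMem_interior (h ▸ he)
  · apply hw
    rw [Submodule.mem_span_singleton]
    refine ⟨-(b⁻¹ * a), ?_⟩
    rw [neg_smul, mul_smul, eq_neg_of_add_eq_zero_left h, smul_neg, neg_neg, inv_smul_smul₀ hb0]

end IsProperCone

namespace IsConePrimitive

variable {T : V →ₗ[ℝ] V} (hT : IsConePrimitive K T)
include hT

theorem apply_mem {x : V} (hx : x ∈ K) : T x ∈ K := hT.1 hx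

theorem pow_apply_mem (k : ℕ) {x : V} (hx : x ∈ K) : (T ^ k) x ∈ K := by
  induction k with
  | zero => simpa
  | succ k ih =>
    rw [pow_succ', Module.End.mul_apply]
    exact hT.apply_mem ih

variable (hK : IsProperCone K)
include hK

/-- The orbit of `x` would be an invariant subset of the boundary. Primitivity is used only in this
form afterwards. -/
theorem eq_zero_of_forall_notMem_interior {x : V} (hx : x ∈ K)
    (h : ∀ k : ℕ, (T ^ k) x ∉ interior (K : Set V)) : x = 0 := by
  have := hT.2 (Set.range fun k : ℕ => (T ^ k) x) (Set.range_nonempty _) ?_ ?_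
  · have h0 : x ∈ Set.range fun k : ℕ => (T ^ k) x := ⟨0, by simp⟩
    rwa [this] at h0
  · rintro _ ⟨k, rfl⟩
    rw [hK.isClosed.frontier_eq]
    exact ⟨hT.pow_apply_mem k hx, h k⟩
  · rintro _ ⟨k, rfl⟩
    exact ⟨k + 1, by simp only [pow_succ', Module.End.mul_apply]⟩

variable [FiniteDimensional ℝ V] (hV : 1 < Module.finrank ℝ V)
include hV

/-- A boundary vector in the kernel has its orbit in the boundary. An interior one dominates a
multiple of every `y`, which forces `T y = 0` on all of `K`, including a nonzero boundary vector. -/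
theorem eq_zero_of_apply_eq_zero {x : V} (hx : x ∈ K) (h : T x = 0) : x = 0 := by
  have : Nontrivial V := Module.nontrivial_of_finrank_pos (R := ℝ) (by omega)
  have hfr : ∀ y ∈ K, T y = 0 → y ∉ interior (K : Set V) → y = 0 := by
    intro y hy hTy hyi
    refine hT.eq_zero_of_forall_notMem_interior hK hy fun k => ?_
    cases k with
    | zero => simpa
    | succ k =>
      rw [pow_succ, Module.End.mul_apply, hTy, map_zero]
      exact hK.zero_notMem_interior
  by_contra hx0
  have hxi : x ∈ interior (K : Set V) := by
    by_contra hxi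
    exact hx0 (hfr x hx h hxi)
  obtain ⟨y, hy, hy0⟩ := hK.exists_mem_frontier_ne_zero hV
  rw [hK.isClosed.frontier_eq] at hy
  refine hy0 (hfr y hy.1 ?_ hy.2)
  obtain ⟨ε, hε, hm⟩ := exists_pos_add_smul_mem_interior hxi (-y)
  have h1 := hT.apply_mem (interior_subset hm)
  rw [map_add, h, zero_add, smul_neg, map_neg, map_smul] at h1
  have h2 := hK.pointed _ (smul_mem_of_nonneg hε.le (hT.apply_mem hy.1)) h1
  exact (smul_eq_zero.1 h2).resolve_left hε.ne'

/-- An interior `x` dominates a multiple of each `z ∈ K`. If `T x` were on the boundary, so would be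
every `T z`, and the orbit of `T x` would never reach the interior. -/
theorem apply_mem_interior {x : V} (hx : x ∈ interior (K : Set V)) :
    T x ∈ interior (K : Set V) := by
  have : Nontrivial V := Module.nontrivial_of_finrank_pos (R := ℝ) (by omega)
  by_contra hTx
  have key : ∀ z ∈ K, T z ∉ interior (K : Set V) := by
    intro z hz hTz
    obtain ⟨ε, hε, hm⟩ := exists_pos_add_smul_mem_interior hx (-z)
    refine hTx ?_
    have h1 := add_mem_interior (smul_mem_interior hε hTz) (hT.apply_mem (interior_subset hm))
    simpa using h1
  have h0 : T x = 0 := by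
    refine hT.eq_zero_of_forall_notMem_interior hK (hT.apply_mem (interior_subset hx)) fun k => ?_
    rw [← Module.End.mul_apply, ← pow_succ, pow_succ', Module.End.mul_apply]
    exact key _ (hT.pow_apply_mem k (interior_subset hx))
  exact hK.zero_notMem_interior
    (hT.eq_zero_of_apply_eq_zero hK hV (interior_subset hx) h0 ▸ hx)

/-- Some power of a primitive operator maps the nonzero vectors of the cone into its interior. -/
theorem exists_pow_mem_interior :
    ∃ m : ℕ, ∀ x ∈ K, x ≠ 0 → (T ^ m) x ∈ interior (K : Set V) := by
  have hcomp : IsCompact ((K : Set V) ∩ Metric.sphere 0 1) :=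
    (isCompact_sphere (0 : V) 1).inter_left hK.isClosed
  have hcont : ∀ k : ℕ, Continuous (T ^ k) := fun k =>
    LinearMap.continuous_of_finiteDimensional _
  have hcov : (K : Set V) ∩ Metric.sphere 0 1 ⊆ ⋃ k : ℕ, (T ^ k) ⁻¹' interior (K : Set V) := by
    rintro x ⟨hx, hx1⟩
    by_contra h
    have := hT.eq_zero_of_forall_notMem_interior hK hx (by simpa using h)
    simp [this] at hx1
  -- Since the cover increases with `k`, compactness yields a single exponent.
  have hmono : Monotone fun k : ℕ => (T ^ k) ⁻¹' interior (K : Set V) := by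
    refine monotone_nat_of_le_succ fun k x hx => ?_
    change (T ^ (k + 1)) x ∈ interior (K : Set V)
    rw [pow_succ', Module.End.mul_apply]
    exact hT.apply_mem_interior hK hV hx
  obtain ⟨m, hm⟩ := hcomp.elim_directed_cover _
    (fun k => isOpen_interior.preimage (hcont k)) hcov hmono.directed_le
  refine ⟨m, fun x hx hx0 => ?_⟩
  have hn : 0 < ‖x‖ := norm_pos_iff.2 hx0
  have h1 : ‖x‖⁻¹ • x ∈ (K : Set V) ∩ Metric.sphere 0 1 :=
    ⟨smul_mem_of_nonneg (inv_nonneg.2 hn.le) hx, by simp [norm_smul, hn.ne']⟩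
  have h2 : (T ^ m) (‖x‖⁻¹ • x) ∈ interior (K : Set V) := hm h1
  have h3 := smul_mem_interior hn h2
  rwa [map_smul, smul_inv_smul₀ hn.ne'] at h3

/-- The Perron eigenvector. -/
theorem exists_eigenvector : ∃ ρ : ℝ, 0 < ρ ∧ ∃ v ∈ interior (K : Set V), T v = ρ • v := by
  have : Nontrivial V := Module.nontrivial_of_finrank_pos (R := ℝ) (by omega)
  obtain ⟨m, hm⟩ := hT.exists_pow_mem_interior hK hV
  have hTc : Continuous T := LinearMap.continuous_of_finiteDimensional _
  obtain ⟨e, he⟩ := hK.solid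
  have he0 : e ≠ 0 := fun h => hK.zero_notMem_interior (h ▸ he)
  obtain ⟨δ, hδ, hδe⟩ := exists_pos_add_smul_mem_interior he (-T e)
  -- Collatz–Wielandt pairs: normalized `x` with `T x ≤ r x` in the cone order. The bound `δ⁻¹`,
  -- attainable at `e`, makes the set compact, so a least `r` exists.
  let S : Set (ℝ × V) := (Set.Icc 0 δ⁻¹ ×ˢ ((K : Set V) ∩ Metric.sphere 0 1)) ∩
    (fun p : ℝ × V => p.1 • p.2 - T p.2) ⁻¹' (K : Set V)
  have hS : IsCompact S :=
    (isCompact_Icc.prod ((isCompact_sphere (0 : V) 1).inter_left hK.isClosed)).inter_right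
      (hK.isClosed.preimage (by fun_prop))
  have hnorm : ∀ (r : ℝ) (x : V), r ∈ Set.Icc 0 δ⁻¹ → x ∈ K → x ≠ 0 → r • x - T x ∈ K →
      (r, ‖x‖⁻¹ • x) ∈ S := by
    intro r x hr hx hx0 h
    have hn : 0 < ‖x‖ := norm_pos_iff.2 hx0
    refine ⟨⟨hr, smul_mem_of_nonneg (inv_nonneg.2 hn.le) hx, by simp [norm_smul, hn.ne']⟩, ?_⟩
    have := smul_mem_of_nonneg (inv_nonneg.2 hn.le) h
    simpa [smul_sub, smul_comm r] using this
  have hSne : S.Nonempty := by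
    refine ⟨_, hnorm δ⁻¹ e ⟨inv_nonneg.2 hδ.le, le_rfl⟩ (interior_subset he) he0 ?_⟩
    have := smul_mem_of_nonneg (inv_nonneg.2 hδ.le) (interior_subset hδe)
    simpa [smul_sub, inv_smul_smul₀ hδ.ne', ← sub_eq_add_neg] using this
  obtain ⟨⟨ρ, x⟩, ⟨⟨hρ, hx, hx1⟩, hρx⟩, hmin⟩ := hS.exists_isMinOn hSne continuous_fst.continuousOn
  simp only [Set.mem_preimage, SetLike.mem_coe] at hρ hx hx1 hρx
  have hx0 : x ≠ 0 := by
    rintro rfl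
    simp at hx1
  have hpos : 0 < ρ := by
    refine lt_of_le_of_ne hρ.1 fun h => ?_
    subst h
    rw [zero_smul, zero_sub] at hρx
    exact hx0 (hT.eq_zero_of_apply_eq_zero hK hV hx
      (hK.pointed _ (hT.apply_mem hx) hρx))
  have heig : T x = ρ • x := by
    -- Otherwise `T ^ m` moves the nonzero slack `ρ • x - T x` into the interior, leaving room to
    -- lower `ρ`.
    by_contra hne
    have h1 := hm _ hρx (sub_ne_zero.2 (Ne.symm hne))
    set y := (T ^ m) x with hy
    have hyi : y ∈ interior (K : Set V) := hm x hx hx0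
    have hTy : (T ^ m) (T x) = T y := by
      rw [hy, ← Module.End.mul_apply, ← pow_succ, pow_succ', Module.End.mul_apply]
    rw [map_sub, map_smul, hTy] at h1
    obtain ⟨ε, hε, hm1⟩ := exists_pos_add_smul_mem_interior h1 (-y)
    have hmem : (ρ - ε) • y - T y ∈ K := by
      have h2 : (ρ - ε) • y - T y = ρ • y - T y + ε • -y := by module
      exact h2 ▸ interior_subset hm1
    have hy0 : y ≠ 0 := fun h => hK.zero_notMem_interior (h ▸ hyi)
    have hnn : 0 ≤ ρ - ε := by
      refine hK.nonneg_of_smul_mem (interior_subset hyi) hy0 ?_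
      have := K.add_mem hmem (hT.apply_mem (interior_subset hyi))
      simpa using this
    have := hmin (hnorm (ρ - ε) y ⟨hnn, by linarith [hρ.2]⟩ (interior_subset hyi) hy0 hmem)
    simp at this
    linarith
  refine ⟨ρ, hpos, x, ?_, heig⟩
  have hpow : ∀ k : ℕ, (T ^ k) x = ρ ^ k • x := by
    intro k
    induction k with
    | zero => simp
    | succ k ih =>
      rw [pow_succ', Module.End.mul_apply, ih, map_smul, heig, smul_smul, pow_succ]
  have := smul_mem_interior (inv_pos.2 (pow_pos hpos m)) (hm x hx hx0)
  rwa [hpow, inv_smul_smul₀ (pow_pos hpos m).ne'] at this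

end IsConePrimitive

namespace IsConePrimitive

variable {T : V →ₗ[ℝ] V} (hT : IsConePrimitive K T) (hK : IsProperCone K)
include hT hK

/-- If `T u = ρ • (u + d • v)` with `v` the Perron vector, then `d` is not positive. -/
theorem nonpos_of_apply_eq_smul_add [Nontrivial V] {ρ : ℝ} (hρ : 0 < ρ) {v : V} (hv : v ∈ interior (K : Set V))
    (hTv : T v = ρ • v) (u : V) (d : ℝ) (hu : T u = ρ • (u + d • v)) : d ≤ 0 := by
  have hv0 : v ≠ 0 := fun h => hK.zero_notMem_interior (h ▸ hv)
  have hvK : v ∈ K := interior_subset hv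
  -- After rescaling, the iterates of `b • v - u` drift linearly along `-v`. A positive `d` would
  -- eventually put a negative multiple of `v` in `K`.
  have hpow : ∀ (k : ℕ) (b : ℝ), (T ^ k) (b • v - u) = ρ ^ k • (b • v - u - (k * d) • v) := by
    intro k b
    induction k with
    | zero => simp
    | succ k ih =>
      rw [pow_succ', Module.End.mul_apply, ih]
      simp only [map_smul, map_sub, hu, hTv]
      push_cast
      module
  have habs : ∀ z : V, ∃ b : ℝ, b • v + z ∈ K := by
    intro z
    obtain ⟨ε, hε, hm⟩ := exists_pos_add_smul_mem_interior hv z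
    refine ⟨ε⁻¹, ?_⟩
    have := smul_mem_of_nonneg (inv_nonneg.2 hε.le) (interior_subset hm)
    simpa [smul_smul, hε.ne'] using this
  obtain ⟨b, hb⟩ := habs u
  obtain ⟨b', hb'⟩ := habs (-u)
  rw [← sub_eq_add_neg] at hb'
  by_contra! hd
  obtain ⟨k, hk⟩ := exists_nat_gt ((b + b') / d)
  rw [div_lt_iff₀ hd] at hk
  have h1 := hT.pow_apply_mem k hb'
  rw [hpow] at h1
  have h2 := smul_mem_of_nonneg (inv_nonneg.2 (pow_pos hρ k).le) h1
  rw [inv_smul_smul₀ (pow_pos hρ k).ne'] at h2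
  have h3 := K.add_mem hb h2
  have h4 : b • v + u + (b' • v - u - (k * d) • v) = (b + b' - k * d) • v := by module
  rw [h4] at h3
  linarith [hK.nonneg_of_smul_mem hvK hv0 h3]

variable [FiniteDimensional ℝ V] (hV : 1 < Module.finrank ℝ V)
include hV

/-- If `x + iy` is an eigenvector for the eigenvalue `μ`, and `‖μ‖` is at least the Perron
eigenvalue, then `x` and `y` are multiples of the Perron vector `v`. When `μ` is real, `y = 0` is
assumed. -/
theorem mem_span_of_le_norm {ρ : ℝ} (hρ : 0 < ρ) {v : V} (hv : v ∈ interior (K : Set V))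
    (hTv : T v = ρ • v) {x y : V} {μ : ℂ} (hx : T x = μ.re • x - μ.im • y)
    (hy : T y = μ.im • x + μ.re • y) (hμ : ρ ≤ ‖μ‖) (hμy : μ.im ≠ 0 ∨ y = 0) :
    x ∈ Submodule.span ℝ {v} ∧ y ∈ Submodule.span ℝ {v} := by
  have : Nontrivial V := Module.nontrivial_of_finrank_pos (R := ℝ) (by omega)
  obtain ⟨m, hm⟩ := hT.exists_pow_mem_interior hK hV
  have hv0 : v ≠ 0 := fun h => hK.zero_notMem_interior (h ▸ hv)
  have hvK : v ∈ K := interior_subset hv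
  by_contra hspan
  -- `w c` is the real part of `c (x + iy)`, so `T` acts on it as multiplication of `c` by `μ`.
  let w : ℂ → V := fun c => c.re • x - c.im • y
  have hwc : Continuous w := by fun_prop
  have hTw : ∀ c, T (w c) = w (c * μ) := by
    intro c
    simp only [w, map_sub, map_smul, hx, hy, Complex.mul_re, Complex.mul_im]
    module
  have hTwpow : ∀ (k : ℕ) c, (T ^ k) (w c) = w (c * μ ^ k) := by
    intro k
    induction k with
    | zero => simp
    | succ k ih =>
      intro c
      rw [pow_succ', Module.End.mul_apply, ih, hTw, mul_assoc, ← pow_succ]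
  have hTvpow : ∀ k : ℕ, (T ^ k) v = ρ ^ k • v := by
    intro k
    induction k with
    | zero => simp
    | succ k ih =>
      rw [pow_succ', Module.End.mul_apply, ih, map_smul, hTv, smul_smul, pow_succ]
  have hwsmul : ∀ (r : ℝ) c, w (r * c) = r • w c := by
    intro r c
    simp [w, smul_sub, smul_smul]
  have hwneg : ∀ c, w (-c) = -w c := by
    intro c
    simp [w]
    abel
  -- For nonreal `μ`, the vectors `w c` and `w (c * μ)` together determine `x` and `y`, so one point
  -- of the ellipse on the line of `v` puts all of it there.
  have hwspan : ∀ c : ℂ, ‖c‖ = 1 → ∀ k : ℝ, 0 < k → w c ≠ (-k) • v := by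
    intro c hc k hk h
    have hmem : w c ∈ Submodule.span ℝ {v} := h ▸ Submodule.mem_span_singleton.2 ⟨_, rfl⟩
    rcases hμy with hb | rfl
    · have hmem2 : w (c * μ) ∈ Submodule.span ℝ {v} := by
        rw [← hTw, h, map_smul, hTv, smul_smul]
        exact Submodule.mem_span_singleton.2 ⟨_, rfl⟩
      have hc2 : c.re ^ 2 + c.im ^ 2 = 1 := by
        have := Complex.sq_norm c
        rw [hc, Complex.normSq_apply] at this
        linarith
      have h1 : μ.im • x = (c * μ).im • w c - c.im • w (c * μ) := by
        have : μ.im = (c.re ^ 2 + c.im ^ 2) * μ.im := by rw [hc2, one_mul]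
        rw [this]
        simp only [w, Complex.mul_re, Complex.mul_im]
        module
      have h2 : μ.im • y = (c * μ).re • w c - c.re • w (c * μ) := by
        have : μ.im = (c.re ^ 2 + c.im ^ 2) * μ.im := by rw [hc2, one_mul]
        rw [this]
        simp only [w, Complex.mul_re, Complex.mul_im]
        module
      refine hspan ⟨?_, ?_⟩
      · rw [← Submodule.smul_mem_iff _ hb, h1]
        exact Submodule.sub_mem _ (Submodule.smul_mem _ _ hmem) (Submodule.smul_mem _ _ hmem2)
      · rw [← Submodule.smul_mem_iff _ hb, h2]
        exact Submodule.sub_mem _ (Submodule.smul_mem _ _ hmem) (Submodule.smul_mem _ _ hmem2)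
    · refine hspan ⟨?_, Submodule.zero_mem _⟩
      have hre : c.re ≠ 0 := by
        intro hre
        simp only [w, hre, zero_smul, smul_zero, sub_zero] at h
        exact smul_ne_zero (neg_ne_zero.2 hk.ne') hv0 h.symm
      rw [← Submodule.smul_mem_iff _ hre]
      simpa [w] using hmem
  have hcirc : IsCompact (Metric.sphere (0 : ℂ) 1) := isCompact_sphere 0 1
  have hopen : ∀ p : ℝ × ℝ, (∀ c ∈ Metric.sphere (0 : ℂ) 1,
      p.1 • v + p.2 • w c ∈ interior (K : Set V)) → ∀ᶠ q : ℝ × ℝ in nhds p,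
      ∀ c ∈ Metric.sphere (0 : ℂ) 1, q.1 • v + q.2 • w c ∈ interior (K : Set V) := by
    intro p hp
    refine hcirc.eventually_forall_of_forall_eventually fun c hc => ?_
    have hcont : Continuous fun q : (ℝ × ℝ) × ℂ => q.1.1 • v + q.1.2 • w q.2 := by fun_prop
    exact hcont.continuousAt.eventually_mem (isOpen_interior.mem_nhds (hp c hc))
  -- The `t` for which the ellipse translated by `t • v` lies in `K`. Its least element will turn
  -- out not to be least.
  let S : Set ℝ := {t | ∀ c ∈ Metric.sphere (0 : ℂ) 1, t • v + w c ∈ K}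
  have hSnn : ∀ t ∈ S, 0 ≤ t := by
    intro t ht
    have h1 := ht 1 (by simp)
    have h2 := ht (-1) (by simp)
    rw [hwneg] at h2
    refine hK.nonneg_of_smul_mem hvK hv0 ?_
    have h3 := smul_mem_of_nonneg (by norm_num : (0 : ℝ) ≤ 1 / 2) (K.add_mem h1 h2)
    have h4 : (1 / 2 : ℝ) • (t • v + w 1 + (t • v + -w 1)) = t • v := by module
    rwa [h4] at h3
  have hSpos : ∀ t ∈ S, 0 < t := by
    intro t ht
    refine lt_of_le_of_ne (hSnn t ht) fun h0 => hspan ?_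
    subst h0
    have hw0 : ∀ c : ℂ, ‖c‖ = 1 → w c = 0 := by
      intro c hc
      have h1 := ht c (by simpa using hc)
      have h2 := ht (-c) (by simpa using hc)
      rw [zero_smul, zero_add] at h1 h2
      exact hK.pointed _ h1 (hwneg c ▸ h2)
    have h1 := hw0 1 (by simp)
    have h2 := hw0 Complex.I (by simp)
    simp [w] at h1 h2
    simp [h1, h2]
  have hSclosed : IsClosed S := by
    have : S = ⋂ c ∈ Metric.sphere (0 : ℂ) 1, (fun t : ℝ => t • v + w c) ⁻¹' (K : Set V) := by
      ext t; simp [S]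
    rw [this]
    exact isClosed_biInter fun c _ => hK.isClosed.preimage (by fun_prop)
  have hSne : S.Nonempty := by
    have h1 := hopen (1, 0) (fun c _ => by simpa using hv)
    have hcont : Continuous fun ε : ℝ => ((1 : ℝ), ε) := by fun_prop
    have h2 := (hcont.tendsto 0).eventually h1
    obtain ⟨ε, hε, hpos⟩ := ((h2.filter_mono nhdsWithin_le_nhds).and
      (self_mem_nhdsWithin (s := Set.Ioi (0 : ℝ)))).exists
    have hpos : 0 < ε := hpos
    refine ⟨ε⁻¹, fun c hc => ?_⟩
    have h3 := smul_mem_of_nonneg (inv_nonneg.2 hpos.le) (interior_subset (hε c hc))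
    simpa [smul_smul, hpos.ne'] using h3
  have hSbdd : BddBelow S := ⟨0, hSnn⟩
  set t := sInf S
  have htS : t ∈ S := hSclosed.csInf_mem hSne hSbdd
  have ht : 0 < t := hSpos t htS
  have hμ0 : 0 < ‖μ‖ := hρ.trans_le hμ
  have hμne : μ ≠ 0 := norm_pos_iff.1 hμ0
  have hint : ∀ c ∈ Metric.sphere (0 : ℂ) 1, t • v + (1 : ℝ) • w c ∈ interior (K : Set V) := by
    intro c hc
    rw [mem_sphere_zero_iff_norm] at hc
    -- The rotation undoes the phase of `μ ^ m`, and the factor `q ≥ 1` compensates for the growth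
    -- `‖μ‖ / ρ`. Thus `T ^ m` sends `(t * q) • v + w c'` to `‖μ‖ ^ m` times the point at `c`.
    set c' : ℂ := c * ((‖μ‖ : ℂ) / μ) ^ m with hc'
    have hc'1 : ‖c'‖ = 1 := by
      simp [hc', hc, hμ0.ne']
    have hq : 1 ≤ (‖μ‖ / ρ) ^ m := one_le_pow₀ ((one_le_div hρ).2 hμ)
    set q := (‖μ‖ / ρ) ^ m with hqdef
    have hmem : (t * q) • v + w c' ∈ K := by
      have h1 := K.add_mem (htS c' (by simpa using hc'1))
        (smul_mem_of_nonneg (mul_nonneg ht.le (sub_nonneg.2 hq)) hvK)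
      have h2 : t • v + w c' + (t * (q - 1)) • v = (t * q) • v + w c' := by module
      rwa [h2] at h1
    have hne : (t * q) • v + w c' ≠ 0 := by
      intro h
      refine hwspan c' hc'1 (t * q) (by positivity) ?_
      rw [neg_smul]
      exact eq_neg_of_add_eq_zero_right h
    have h1 := hm _ hmem hne
    have h2 : c' * μ ^ m = ((‖μ‖ ^ m : ℝ) : ℂ) * c := by
      rw [hc', mul_assoc, ← mul_pow, div_mul_cancel₀ _ hμne]
      push_cast
      ring
    have h3 : t * q * ρ ^ m = ‖μ‖ ^ m * t := by
      rw [hqdef, div_pow]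
      field_simp
    rw [map_add, map_smul, hTvpow, hTwpow, h2, hwsmul, smul_smul, h3, mul_smul, ← smul_add] at h1
    have h4 := smul_mem_interior (inv_pos.2 (pow_pos hμ0 m)) h1
    rwa [inv_smul_smul₀ (pow_pos hμ0 m).ne', ← one_smul ℝ (w c)] at h4
  -- The whole translated ellipse is interior, and the circle is compact, so a slightly smaller `t`
  -- still works.
  have h1 := hopen (t, 1) hint
  have hcont : Continuous fun s : ℝ => (s, (1 : ℝ)) := by fun_prop
  have h2 := (hcont.tendsto t).eventually h1
  obtain ⟨s, hs, hst⟩ := ((h2.filter_mono nhdsWithin_le_nhds).and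
    (self_mem_nhdsWithin (s := Set.Iio t))).exists
  refine (csInf_le hSbdd (a := s) fun c hc => ?_).not_gt hst
  simpa using interior_subset (hs c hc)

/-- The eigenspace is the line of `v` by `mem_span_of_le_norm`. A Jordan block would give `T x = ρ •
x + a • v` with `a ≠ 0`, which `nonpos_of_apply_eq_smul_add` excludes when applied to `x` and `-x`.
-/
theorem rootMultiplicity_charpoly {ρ : ℝ} (hρ : 0 < ρ) {v : V} (hv : v ∈ interior (K : Set V))
    (hTv : T v = ρ • v) : T.charpoly.rootMultiplicity ρ = 1 := by
  have : Nontrivial V := Module.nontrivial_of_finrank_pos (R := ℝ) (by omega)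
  have hv0 : v ≠ 0 := fun h => hK.zero_notMem_interior (h ▸ hv)
  have heig : ∀ x, T x = ρ • x → x ∈ Submodule.span ℝ {v} := by
    intro x hx
    exact (hT.mem_span_of_le_norm hK hV hρ hv hTv (x := x) (y := 0) (μ := (ρ : ℂ))
      (by simpa using hx) (by simp) (by simp [le_abs_self]) (Or.inr rfl)).1
  have hstep : ∀ x, T x - ρ • x ∈ Submodule.span ℝ {v} → T x = ρ • x := by
    intro x hx
    obtain ⟨a, ha⟩ := Submodule.mem_span_singleton.1 hx
    have h1 : a / ρ ≤ 0 := by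
      refine hT.nonpos_of_apply_eq_smul_add hK hρ hv hTv x (a / ρ) ?_
      rw [smul_add, smul_smul, mul_div_cancel₀ _ hρ.ne', ha]
      abel
    have h2 : -a / ρ ≤ 0 := by
      refine hT.nonpos_of_apply_eq_smul_add hK hρ hv hTv (-x) (-a / ρ) ?_
      rw [smul_add, smul_smul, mul_div_cancel₀ _ hρ.ne', neg_smul, ha, map_neg, smul_neg]
      abel
    rw [neg_div] at h2
    have h3 : a / ρ = 0 := by linarith
    have h4 : a = 0 := by simpa [hρ.ne'] using h3
    rw [h4, zero_smul] at ha
    exact sub_eq_zero.1 ha.symm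
  have hgen : Module.End.maxGenEigenspace T ρ = Submodule.span ℝ {v} := by
    apply le_antisymm
    · intro x hx
      obtain ⟨k, hk⟩ := Module.End.mem_maxGenEigenspace T ρ x |>.1 hx
      clear hx
      induction k generalizing x with
      | zero => simp at hk; simp [hk]
      | succ k ih =>
        rw [pow_succ, Module.End.mul_apply] at hk
        exact heig x (hstep x (by simpa using ih hk))
    · rw [Submodule.span_singleton_le_iff_mem, Module.End.mem_maxGenEigenspace]
      exact ⟨1, by simp [hTv]⟩
  rw [← LinearMap.finrank_maxGenEigenspace_eq, hgen, finrank_span_singleton hv0]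

end IsConePrimitive

end ProperCone

/-! ### Dominance among complex eigenvalues. -/

open PointedCone Polynomial

theorem LinearMap.exists_re_im_eigenvector {ι : Type*} [Fintype ι] (T : (ι → ℝ) →ₗ[ℝ] (ι → ℝ))
    {μ : ℂ} (hμ : μ ∈ T.charpoly.aroots ℂ) :
    ∃ x y : ι → ℝ, (x ≠ 0 ∨ y ≠ 0) ∧ T x = μ.re • x - μ.im • y ∧ T y = μ.im • x + μ.re • y := by
  classical
  set e := Pi.basisFun ℝ ι
  set M := LinearMap.toMatrix e e T with hM
  set f : Module.End ℂ (ι → ℂ) := Matrix.toLin' (M.map (algebraMap ℝ ℂ)) with hf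
  have hroot : f.charpoly.IsRoot μ := by
    have hfM : LinearMap.toMatrix (Pi.basisFun ℂ ι) (Pi.basisFun ℂ ι) f =
        M.map (algebraMap ℝ ℂ) := by
      rw [hf, ← Matrix.toLin_eq_toLin']
      exact LinearMap.toMatrix_toLin _ _ _
    rw [← LinearMap.charpoly_toMatrix f (Pi.basisFun ℂ ι), hfM, Matrix.charpoly_map, hM,
      LinearMap.charpoly_toMatrix]
    exact isRoot_of_mem_roots hμ
  obtain ⟨z, hz⟩ := (Module.End.hasEigenvalue_iff_isRoot_charpoly f μ |>.2 hroot).exists_hasEigenvector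
  have hTM : ∀ x i, T x i = ∑ k, M i k * x k := by
    intro x i
    have h := congrFun (LinearMap.toMatrix_mulVec_repr e e T x) i
    rw [← hM] at h
    simpa only [e, Matrix.mulVec, dotProduct, Pi.basisFun_repr] using h.symm
  have hzi : ∀ i, ∑ k, (M i k : ℂ) * z k = μ * z i := by
    intro i
    have := congrFun hz.apply_eq_smul i
    simpa [hf, Matrix.mulVec, dotProduct] using this
  refine ⟨fun i => (z i).re, fun i => (z i).im, ?_, ?_, ?_⟩
  · by_contra! h
    refine hz.2 (funext fun i => Complex.ext (congrFun h.1 i) (congrFun h.2 i))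
  · ext i
    rw [hTM]
    simpa using congrArg Complex.re (hzi i)
  · ext i
    rw [hTM]
    have := congrArg Complex.im (hzi i)
    simp at this
    simp [this]
    ring

/-- Perron–Frobenius: a primitive operator on a space of dimension at least two has a positive
simple eigenvalue which strictly dominates all other complex eigenvalues. -/
theorem IsConePrimitive.exists_dominant_eigenvalue {ι : Type*} [Fintype ι]
    {K : PointedCone ℝ (ι → ℝ)} {T : (ι → ℝ) →ₗ[ℝ] (ι → ℝ)} (hT : IsConePrimitive K T)
    (hK : IsProperCone K) (hι : 1 < Fintype.card ι) :
    ∃ ρ : ℝ, 0 < ρ ∧ (T.charpoly.aroots ℂ).count (ρ : ℂ) = 1 ∧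
      ∀ μ ∈ T.charpoly.aroots ℂ, μ ≠ ρ → ‖μ‖ < ρ := by
  have hV : 1 < Module.finrank ℝ (ι → ℝ) := by simpa using hι
  obtain ⟨ρ, hρ, v, hv, hTv⟩ := hT.exists_eigenvector hK hV
  refine ⟨ρ, hρ, ?_, fun μ hμ hne => ?_⟩
  · rw [aroots_def, count_roots, ← hT.rootMultiplicity_charpoly hK hV hρ hv hTv]
    exact (eq_rootMultiplicity_map (algebraMap ℝ ℂ).injective ρ).symm
  · obtain ⟨x, y, hxy, hx, hy⟩ := T.exists_re_im_eigenvector hμ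
    by_contra! hle
    have hcollinear : x ∈ Submodule.span ℝ {v} ∧ y ∈ Submodule.span ℝ {v} := by
      by_cases him : μ.im = 0
      · rw [him, zero_smul] at hx hy
        rw [sub_zero] at hx
        rw [zero_add] at hy
        exact ⟨(hT.mem_span_of_le_norm hK hV hρ hv hTv (x := x) (y := 0) (μ := μ)
            (by simpa using hx) (by simp [him]) hle (Or.inr rfl)).1,
          (hT.mem_span_of_le_norm hK hV hρ hv hTv (x := y) (y := 0) (μ := μ)
            (by simpa using hy) (by simp [him]) hle (Or.inr rfl)).1⟩
      · exact hT.mem_span_of_le_norm hK hV hρ hv hTv hx hy hle (Or.inl him)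
    have heig : ∀ z ∈ Submodule.span ℝ {v}, T z = ρ • z := by
      intro z hz
      obtain ⟨a, rfl⟩ := Submodule.mem_span_singleton.1 hz
      rw [map_smul, hTv, smul_comm]
    rw [heig _ hcollinear.1] at hx
    rw [heig _ hcollinear.2] at hy
    have key : ∀ i, (μ - ρ) * ((x i : ℂ) + (y i : ℂ) * Complex.I) = 0 := by
      intro i
      have h1 := congrFun hx i
      have h2 := congrFun hy i
      simp at h1 h2
      apply Complex.ext
      · simp; linarith
      · simp; linarith
    have hz : ∀ i, (x i : ℂ) + (y i : ℂ) * Complex.I = 0 := fun i =>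
      (mul_eq_zero.1 (key i)).resolve_left (sub_ne_zero.2 hne)
    rcases hxy with h | h
    · exact h (funext fun i => by simpa using congrArg Complex.re (hz i))
    · exact h (funext fun i => by simpa using congrArg Complex.im (hz i))

/-- On a one-dimensional coordinate space, the eigenvalue of a cone-preserving operator is
nonnegative. -/
theorem IsConePrimitive.nonneg_of_charpoly_aroots {ι : Type*} [Fintype ι]
    {K : PointedCone ℝ (ι → ℝ)} {T : (ι → ℝ) →ₗ[ℝ] (ι → ℝ)} (hT : IsConePrimitive K T)
    (hK : IsProperCone K) (hι : Fintype.card ι = 1) {μ : ℂ} (hμ : T.charpoly.aroots ℂ = {μ}) :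
    ∃ r : ℝ, 0 ≤ r ∧ μ = r := by
  have hV : Module.finrank ℝ (ι → ℝ) = 1 := by simpa using hι
  have : Nontrivial (ι → ℝ) := Module.nontrivial_of_finrank_pos (R := ℝ) (by omega)
  obtain ⟨v, hv⟩ := hK.solid
  have hv0 : v ≠ 0 := fun h => hK.zero_notMem_interior (h ▸ hv)
  obtain ⟨r, hr⟩ := (finrank_eq_one_iff_of_nonzero' v hv0).1 hV (T v)
  refine ⟨r, hK.nonneg_of_smul_mem (interior_subset hv) hv0
    (hr ▸ hT.apply_mem (interior_subset hv)), ?_⟩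
  have hroot : T.charpoly.IsRoot r :=
    (Module.End.hasEigenvalue_iff_isRoot_charpoly T r).1
      (Module.End.hasEigenvalue_of_hasEigenvector
        ⟨Module.End.mem_eigenspace_iff.2 hr.symm, hv0⟩)
  have hmem : (r : ℂ) ∈ T.charpoly.aroots ℂ := by
    rw [mem_aroots]
    refine ⟨T.charpoly_monic.ne_zero, ?_⟩
    have := aeval_algebraMap_apply ℂ r T.charpoly
    simpa [hroot.eq_zero] using this
  rw [hμ, Multiset.mem_singleton] at hmem
  exact hmem.symm

/-! ### From exterior powers to the ordered spectrum. -/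

open Polynomial

/-- After cancelling common indices, equally many factors remain on both sides, and `f j` separates
them. -/
theorem Finset.prod_le_prod_Icc_of_antitone {n j : ℕ} (hj : j ≤ n) {f : ℕ → ℝ}
    (h0 : ∀ i, 0 ≤ f i) (hf : ∀ i k : ℕ, 1 ≤ i → i ≤ k → k ≤ n → f k ≤ f i)
    {I : Finset ℕ} (hI : I ⊆ Finset.Icc 1 n) (hcard : I.card = j) :
    ∏ i ∈ I, f i ≤ ∏ i ∈ Finset.Icc 1 j, f i := by
  set J := Finset.Icc 1 j with hJ
  have hJcard : J.card = j := by simp [hJ]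
  have hdiff : (I \ J).card = (J \ I).card := by
    have h1 := Finset.card_sdiff_add_card_inter I J
    have h2 := Finset.card_sdiff_add_card_inter J I
    rw [Finset.inter_comm] at h2
    omega
  have h1 : ∏ i ∈ I \ J, f i ≤ f j ^ (I \ J).card := by
    rw [← Finset.prod_const]
    refine Finset.prod_le_prod (fun i _ => h0 i) fun i hi => ?_
    obtain ⟨hiI, hiJ⟩ := Finset.mem_sdiff.1 hi
    have h2 := Finset.mem_Icc.1 (hI hiI)
    rw [hJ, Finset.mem_Icc] at hiJ
    rcases Nat.eq_zero_or_pos j with rfl | hj0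
    · rw [Finset.card_eq_zero.1 hcard] at hiI
      simp at hiI
    · exact hf j i hj0 (by omega) h2.2
  have h2 : f j ^ (J \ I).card ≤ ∏ i ∈ J \ I, f i := by
    rw [← Finset.prod_const]
    refine Finset.prod_le_prod (fun _ _ => h0 j) fun i hi => ?_
    have h3 := Finset.mem_Icc.1 (Finset.mem_sdiff.1 hi).1
    exact hf i j h3.1 h3.2 hj
  rw [← Finset.prod_inter_mul_prod_sdiff I J, ← Finset.prod_inter_mul_prod_sdiff J I,
    Finset.inter_comm J I]
  refine mul_le_mul_of_nonneg_left ?_ (Finset.prod_nonneg fun i _ => h0 i)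
  rw [hdiff] at h1
  exact h1.trans h2

/-- The multiplicity bound mentions no enumeration, so its proof needs one to exist. -/
theorem exists_isEigenvalueEnumeration {n : ℕ} (A : (Fin n → ℝ) →ₗ[ℝ] (Fin n → ℝ)) :
    ∃ ev, IsEigenvalueEnumeration A ev := by
  classical
  set l := (A.charpoly.aroots ℂ).toList.insertionSort (fun a b => ‖b‖ ≤ ‖a‖) with hl
  have hperm : (l : Multiset ℂ) = A.charpoly.aroots ℂ := by
    conv_rhs => rw [← Multiset.coe_toList (A.charpoly.aroots ℂ)]
    exact Multiset.coe_eq_coe.2 (List.perm_insertionSort _ _)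
  have hlen : l.length = n := by
    rw [← Multiset.coe_card, hperm, aroots_def, ← (IsAlgClosed.splits _).natDegree_eq_card_roots,
      natDegree_map, LinearMap.charpoly_natDegree, Module.finrank_fin_fun]
  have : Std.Total (fun a b : ℂ => ‖b‖ ≤ ‖a‖) := ⟨fun a b => le_total _ _⟩
  have : IsTrans ℂ (fun a b : ℂ => ‖b‖ ≤ ‖a‖) := ⟨fun a b c h1 h2 => h2.trans h1⟩
  have hsort : l.Pairwise (fun a b => ‖b‖ ≤ ‖a‖) := List.pairwise_insertionSort _ _
  refine ⟨fun i => l.getD (i - 1) 0, ?_, ?_⟩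
  · rw [← hperm, ← hlen]
    have h1 : Finset.Icc 1 l.length = (Finset.range l.length).map (addRightEmbedding 1) := by
      rw [Finset.range_eq_Ico, Finset.map_add_right_Ico]
      rfl
    rw [h1, Finset.map_val, Multiset.map_map, Finset.range_val, Multiset.range, Multiset.map_coe]
    congr 1
    refine List.ext_getElem (by simp) fun i h1 h2 => ?_
    simp [h2]
  · intro i k hi hik hk
    rcases hik.eq_or_lt with rfl | hlt
    · rfl
    · have h := List.pairwise_iff_getElem.1 hsort (i - 1) (k - 1) (by omega) (by omega) (by omega)
      simpa [List.getD_eq_getElem, show i - 1 < l.length by omega,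
        show k - 1 < l.length by omega] using h

namespace IsEigenvalueEnumeration

variable {n : ℕ} {A : (Fin n → ℝ) →ₗ[ℝ] (Fin n → ℝ)} {ev : ℕ → ℂ}
  (hev : IsEigenvalueEnumeration A ev)
include hev

theorem mem_aroots_iff (μ : ℂ) :
    μ ∈ A.charpoly.aroots ℂ ↔ ∃ i, 1 ≤ i ∧ i ≤ n ∧ ev i = μ := by
  simp [← hev.eigenvalues, and_assoc]

theorem aroots_exteriorPowerOperator (j : ℕ) :
    (exteriorPowerOperator j A).charpoly.aroots ℂ =
      ((Finset.Icc 1 n).powersetCard j).val.map fun I => ∏ i ∈ I, ev i := by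
  rw [charpoly_aroots_exteriorPowerOperator, ← hev.eigenvalues, Multiset.powersetCard_map,
    Multiset.map_map, ← Finset.map_val_val_powersetCard, Multiset.map_map]
  rfl

theorem spectralRadius_eq (hn : 1 ≤ n) : spectralRadius ℂ (A.baseChange ℂ) = ‖ev 1‖ₑ := by
  have hspec : ∀ μ : ℂ, μ ∈ spectrum ℂ (A.baseChange ℂ) ↔ ∃ i, 1 ≤ i ∧ i ≤ n ∧ ev i = μ := by
    intro μ
    rw [Module.End.mem_spectrum_iff_isRoot_charpoly, LinearMap.charpoly_baseChange,
      ← hev.mem_aroots_iff, aroots_def,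
      mem_roots (map_monic_ne_zero A.charpoly_monic)]
  apply le_antisymm
  · refine iSup₂_le fun μ hμ => ?_
    obtain ⟨i, hi, hin, rfl⟩ := (hspec μ).1 hμ
    exact enorm_le_iff_norm_le.2 (hev.antitone 1 i le_rfl hi hin)
  · exact le_iSup₂ (f := fun (μ : ℂ) (_ : μ ∈ spectrum ℂ (A.baseChange ℂ)) => ‖μ‖ₑ)
      (ev 1) ((hspec _).2 ⟨1, le_rfl, hn, rfl⟩)

variable (hA : IsGeneralizedEvenOscillatory A)
include hA

/-- The product of the `j` leading eigenvalues is the Perron eigenvalue of the `j`-th exterior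
power. -/
theorem prod_pos_and_norm_lt {j : ℕ} (hj : 1 ≤ j) (hjn : j < n) (he : Even j) :
    (∃ r : ℝ, 0 < r ∧ ∏ i ∈ Finset.Icc 1 j, ev i = r) ∧ ‖ev (j + 1)‖ < ‖ev j‖ := by
  obtain ⟨K, hK, hT⟩ := hA j hj hjn.le he
  have hcard : 1 < Fintype.card (Set.powersetCard (Fin n) j) := by
    rw [← Nat.card_eq_fintype_card, Set.powersetCard.card, Nat.card_fin]
    obtain ⟨j, rfl⟩ := Nat.exists_eq_add_of_le' hj
    obtain ⟨n, rfl⟩ := Nat.exists_eq_add_of_le' (hj.trans hjn.le)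
    rw [Nat.choose_succ_succ']
    have h1 : 0 < n.choose j := Nat.choose_pos (by omega)
    have h2 : 0 < n.choose (j + 1) := Nat.choose_pos (by omega)
    omega
  obtain ⟨ρ, hρ, hcount, hdom⟩ := hT.exists_dominant_eigenvalue hK hcard
  rw [hev.aroots_exteriorPowerOperator] at hcount hdom
  have hmem : ∀ I ⊆ Finset.Icc 1 n, I.card = j → ∏ i ∈ I, ev i ∈
      ((Finset.Icc 1 n).powersetCard j).val.map fun I => ∏ i ∈ I, ev i := by
    intro I hI hIc
    exact Multiset.mem_map_of_mem _ (Finset.mem_powersetCard.2 ⟨hI, hIc⟩)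
  have hI₀ : Finset.Icc 1 j ⊆ Finset.Icc 1 n := Finset.Icc_subset_Icc_right hjn.le
  have hc₀ : (Finset.Icc 1 j).card = j := by simp
  -- The dominant `ρ` is some product of `j` eigenvalues, and none exceeds the leading one in
  -- modulus.
  have h₀ : ∏ i ∈ Finset.Icc 1 j, ev i = ρ := by
    by_contra hne
    have hlt := hdom _ (hmem _ hI₀ hc₀) hne
    have hρmem := Multiset.count_pos.1 (hcount.symm ▸ one_pos)
    obtain ⟨I, hI, hIρ⟩ := Multiset.mem_map.1 hρmem
    rw [Finset.mem_val, Finset.mem_powersetCard] at hI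
    have h1 := Finset.prod_le_prod_Icc_of_antitone hjn.le (f := fun i => ‖ev i‖)
      (fun i => norm_nonneg _) hev.antitone hI.1 hI.2
    rw [← norm_prod, ← norm_prod, hIρ, Complex.norm_real, Real.norm_of_nonneg hρ.le] at h1
    exact hlt.not_ge h1
  refine ⟨⟨ρ, hρ, h₀⟩, ?_⟩
  set P := Finset.Icc 1 (j - 1) with hP
  have hjP : j ∉ P := by simp [hP]; omega
  have hjP' : j + 1 ∉ P := by simp [hP]
  have hI₀' : Finset.Icc 1 j = insert j P := by
    ext i; simp [hP]; omega
  have hI₁ : insert (j + 1) P ⊆ Finset.Icc 1 n := by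
    intro i; simp [hP]; omega
  have hc₁ : (insert (j + 1) P).card = j := by
    rw [Finset.card_insert_of_notMem hjP', hP, Nat.card_Icc]
    omega
  -- Two index sets with product `ρ` would contradict its simplicity.
  have hne : ∏ i ∈ insert (j + 1) P, ev i ≠ ρ := by
    intro h₁
    rw [Multiset.count_map] at hcount
    have hsub : ({insert j P, insert (j + 1) P} : Finset (Finset ℕ)) ⊆
        ((Finset.Icc 1 n).powersetCard j).filter fun I => (ρ : ℂ) = ∏ i ∈ I, ev i := by
      intro I hI
      rw [Finset.mem_filter, Finset.mem_powersetCard]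
      rcases Finset.mem_insert.1 hI with rfl | hI
      · exact ⟨⟨hI₀' ▸ hI₀, hI₀' ▸ hc₀⟩, by rw [← hI₀', h₀]⟩
      · rw [Finset.mem_singleton.1 hI]
        exact ⟨⟨hI₁, hc₁⟩, h₁.symm⟩
    have h2 := Finset.card_le_card hsub
    rw [Finset.card_pair] at h2
    · rw [Finset.card_def, Finset.filter_val] at h2
      omega
    · intro h
      have : j ∈ insert (j + 1) P := h ▸ Finset.mem_insert_self j P
      simp [hjP] at this
  have hlt := hdom _ (hmem _ hI₁ hc₁) hne
  rw [Finset.prod_insert hjP', norm_mul] at hlt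
  rw [hI₀', Finset.prod_insert hjP] at h₀
  have h3 := congrArg norm h₀
  rw [norm_mul, Complex.norm_real, Real.norm_of_nonneg hρ.le] at h3
  rw [← h3] at hlt
  exact lt_of_mul_lt_mul_right hlt (norm_nonneg _)

/-- For `j = n` the exterior power is one-dimensional, where primitivity allows the eigenvalue zero;
hence positivity is claimed only for `j < n`. -/
theorem prod_nonneg {j : ℕ} (hjn : j ≤ n) (he : Even j) :
    ∃ r : ℝ, 0 ≤ r ∧ (j < n → 0 < r) ∧ ∏ i ∈ Finset.Icc 1 j, ev i = r := by
  rcases Nat.eq_zero_or_pos j with rfl | hj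
  · exact ⟨1, zero_le_one, fun _ => one_pos, by simp⟩
  rcases hjn.eq_or_lt with rfl | hlt
  · obtain ⟨K, hK, hT⟩ := hA j hj le_rfl he
    have hroots := hev.aroots_exteriorPowerOperator j
    have hself : (Finset.Icc 1 j).powersetCard j = {Finset.Icc 1 j} := by
      simpa using Finset.powersetCard_self (Finset.Icc 1 j)
    rw [hself] at hroots
    obtain ⟨r, hr, h⟩ := hT.nonneg_of_charpoly_aroots hK (by
      rw [← Nat.card_eq_fintype_card, Set.powersetCard.card, Nat.card_fin, Nat.choose_self])
      (by simpa using hroots)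
    exact ⟨r, hr, fun h => absurd h (lt_irrefl _), h⟩
  · obtain ⟨⟨r, hr, h⟩, -⟩ := hev.prod_pos_and_norm_lt hA hj hlt he
    exact ⟨r, hr.le, fun _ => hr, h⟩

/-- The product of the pair is a quotient of two even leading products, hence positive. -/
theorem arg_eq_neg_arg {i : ℕ} (hi : Odd i) (hin : i + 1 ≤ n) (h0 : ev (i + 1) ≠ 0) :
    ((ev (i + 1)).arg : Real.Angle) = -((ev i).arg : Real.Angle) := by
  obtain ⟨k, rfl⟩ := hi
  have h0' : ev (2 * k + 1) ≠ 0 := by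
    have := hev.antitone (2 * k + 1) (2 * k + 1 + 1) (by omega) (by omega) hin
    exact norm_pos_iff.1 ((norm_pos_iff.2 h0).trans_le this)
  obtain ⟨p, -, hp, hpe⟩ := hev.prod_nonneg hA (j := 2 * k) (by omega) (even_two_mul k)
  obtain ⟨q, hq, -, hqe⟩ := hev.prod_nonneg hA (j := 2 * k + 1 + 1) hin ⟨k + 1, by ring⟩
  have hp : 0 < p := hp (by omega)
  rw [Finset.prod_Icc_succ_top (by omega), Finset.prod_Icc_succ_top (by omega), hpe] at hqe
  have hq0 : 0 < q := by
    refine lt_of_le_of_ne hq fun h => ?_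
    rw [← h, Complex.ofReal_zero] at hqe
    simp [hp.ne', h0, h0'] at hqe
  have hmul : ev (2 * k + 1) * ev (2 * k + 1 + 1) = ((q / p : ℝ) : ℂ) := by
    have : (p : ℂ) ≠ 0 := by exact_mod_cast hp.ne'
    push_cast
    rw [← hqe]
    field_simp
  have h := Complex.arg_mul_coe_angle h0' h0
  rw [hmul, Complex.arg_ofReal_of_nonneg (by positivity), Real.Angle.coe_zero] at h
  exact eq_neg_of_add_eq_zero_right h.symm

/-- The conjugate is an eigenvalue of the same modulus, and the gap after the even index `n - 1`
leaves only `ev n` itself. -/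
theorem im_last_eq_zero (hn : Odd n) : (ev n).im = 0 := by
  have hn1 : 1 ≤ n := hn.pos
  have hmem : (starRingEnd ℂ) (ev n) ∈ A.charpoly.aroots ℂ := by
    have h := (hev.mem_aroots_iff (ev n)).2 ⟨n, hn1, le_rfl, rfl⟩
    rw [mem_aroots] at h ⊢
    exact ⟨h.1, by rw [aeval_conj, h.2, map_zero]⟩
  obtain ⟨k, hk, hkn, hkc⟩ := (hev.mem_aroots_iff _).1 hmem
  rcases hkn.eq_or_lt with rfl | hlt
  · exact Complex.conj_eq_iff_im.1 hkc.symm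
  · have h1 := (hev.prod_pos_and_norm_lt hA (j := n - 1) (by omega) (by omega) (Nat.Odd.sub_odd hn odd_one)).2
    have h2 := hev.antitone k (n - 1) hk (by omega) (by omega)
    rw [hkc, Complex.norm_conj] at h2
    rw [Nat.sub_add_cancel hn1] at h1
    exact absurd h1 h2.not_gt

/-- Between an index and any other at least two further on, some even position forces a strict drop
in modulus. -/
theorem count_aroots_le_two (μ : ℂ) : (A.charpoly.aroots ℂ).count μ ≤ 2 := by
  rw [← hev.eigenvalues, Multiset.count_map, ← Finset.filter_val, ← Finset.card_def]
  set F := (Finset.Icc 1 n).filter fun i => μ = ev i with hF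
  rcases F.eq_empty_or_nonempty with h | h
  · simp [h]
  obtain ⟨ha1, han, hae⟩ : 1 ≤ F.min' h ∧ F.min' h ≤ n ∧ μ = ev (F.min' h) := by
    simpa [hF, and_assoc] using F.min'_mem h
  set a := F.min' h
  have hsub : F ⊆ {a, a + 1} := by
    intro c hc
    have hac : a ≤ c := F.min'_le c hc
    obtain ⟨-, hcn, hce⟩ : 1 ≤ c ∧ c ≤ n ∧ μ = ev c := by simpa [hF, and_assoc] using hc
    by_contra hne
    simp only [Finset.mem_insert, Finset.mem_singleton, not_or] at hne
    obtain ⟨e, hae', hec, he⟩ : ∃ e, a ≤ e ∧ e + 1 ≤ c ∧ Even e := by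
      rcases Nat.even_or_odd a with h | h
      · exact ⟨a, le_rfl, by omega, h⟩
      · exact ⟨a + 1, by omega, by omega, h.add_one⟩
    have h1 := (hev.prod_pos_and_norm_lt hA (j := e) (by omega) (by omega) he).2
    have h2 := hev.antitone a e ha1 hae' (by omega)
    have h3 := hev.antitone (e + 1) c (by omega) hec hcn
    rw [← hce, hae] at h3
    linarith
  exact (Finset.card_le_card hsub).trans Finset.card_le_two

end IsEigenvalueEnumeration

theorem theorem4 (n : ℕ) (hn : 1 ≤ n) (A : (Fin n → ℝ) →ₗ[ℝ] (Fin n → ℝ))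
    (hA : IsGeneralizedEvenOscillatory A) :
    -- every eigenvalue has algebraic multiplicity at most two
    (∀ μ : ℂ, (A.charpoly.map (algebraMap ℝ ℂ)).rootMultiplicity μ ≤ 2) ∧
    ∀ ev : ℕ → ℂ, IsEigenvalueEnumeration A ev →
      -- the spectral radius is the modulus of the first eigenvalue
      spectralRadius ℂ (A.baseChange ℂ) = ‖ev 1‖ₑ ∧
      -- the moduli satisfy `|ev 1| ≥ |ev 2| > |ev 3| ≥ |ev 4| > ⋯`
      (∀ i : ℕ, Odd i → i + 1 ≤ n → ‖ev (i + 1)‖ ≤ ‖ev i‖) ∧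
      (∀ i : ℕ, 1 ≤ i → Even i → i + 1 ≤ n → ‖ev (i + 1)‖ < ‖ev i‖) ∧
      -- opposite arguments (modulo `2π`) in each pair, wherever the arguments are defined
      (∀ i : ℕ, Odd i → i + 1 ≤ n → ev (i + 1) ≠ 0 →
        ((ev (i + 1)).arg : Real.Angle) = -((ev i).arg : Real.Angle)) ∧
      -- for odd `n` the last eigenvalue is real
      (Odd n → (ev n).im = 0) := by
  refine ⟨fun μ => ?_, fun ev hev => ⟨hev.spectralRadius_eq hn, fun i hi hin => ?_,
    fun i hi he hin => (hev.prod_pos_and_norm_lt hA hi hin he).2,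
    fun i hi hin h0 => hev.arg_eq_neg_arg hA hi hin h0, hev.im_last_eq_zero hA⟩⟩
  · obtain ⟨ev, hev⟩ := exists_isEigenvalueEnumeration A
    simpa only [aroots_def, count_roots] using hev.count_aroots_le_two hA μ
  · exact hev.antitone i (i + 1) hi.pos (Nat.le_succ i) hin
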